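/- Let $A$ be a small category with object set $X$; write $s(a)$, $t(a)$ for the source and target of an arrow $a$, and $a.b$ for the composite ("first $b$, then $a$") of arrows with $s(a)=t(b)$. A span over $X$ is a set $Q$ with two maps $s,t:Q\to X$; morphisms of spans are maps commuting with $s$ and $t$. For spans $M,N$ over $X$ put $$M\circ N=\{(m,n)\mid s(m)=t(n)\},\qquad M\bullet N=\{(m,n)\mid s(m)=s(n),\ t(m)=t(n)\};$$ here $s(m,n)=s(n)$, $t(m,n)=t(m)$ in $M\circ N$, while $s(m,n)=s(m)$, $t(m,n)=t(m)$ in $M\bullet N$. Let $I$ be the span $X$ with $s=t=\mathrm{id}$. The arrows of $A$ form a span over $X$, again denoted $A$, which is a monoid with respect to $\circ$ (and a bimonoid in the duoidal category $\mathsf{span}(X)$ of spans over $X$, as $\bullet$ is the cartesian product). A (right) $A$-module is a span $Q$ over $X$ with an associative and unital morphism of spans $Q\circ A\to Q$, $(q,a)\mapsto q.a$; morphisms of modules are morphisms of spans commuting with the actions. The category $A$ is a module over itself by composition. For a module $Q$, the span $(Q\bullet I)\circ A\cong\{(q,a)\mid s(q)=t(q)=t(a)\}$ is a module via $(q,a).b=(q,a.b)$,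 and $Q\bullet A$ is a module via $(q,a).b=(q.b,a.b)$. An $A$-Hopf module is an $A$-module $Q$ with a morphism of modules $c:Q\to A$; a morphism $(Q,c)\to(Q',c')$ of $A$-Hopf modules is a morphism of modules $f:Q\to Q'$ with $c'f=c$. The following assertions are equivalent. (i) $A$ is a groupoid. (ii) The natural transformation $$\beta_Q:(Q\bullet I)\circ A\to Q\bullet A,\qquad (q,a)\mapsto(q.a,a),$$ between endofunctors of the category of $A$-modules is an isomorphism (equivalently, $\beta_Q$ is bijective for every $A$-module $Q$). (iii) The canonical comparison functor from the slice category $\mathsf{set}/X$ to the category of $A$-Hopf modules is an equivalence. It sends $f:Z\to X$ to $Z\circ A=\{(z,a)\mid f(z)=t(a)\}$ (where $Z$ is regarded as a span with $s=t=f$) with action $(z,a).b=(z,a.b)$ and $c(z,a)=a$, and a morphism $h$ of $\mathsf{set}/X$ to $(z,a)\mapsto(h(z),a)$. -/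

import Mathlib

open CategoryTheory

universe u

/- Let `x ⟶ y` always mean the hom type of the category structure. -/
attribute [-instance] catToReflQuiver

namespace SpanHopf

/-- A span over the set `X`: a set together with a target map and a source map to `X`. -/
structure Span (X : Type u) : Type (u + 1) where
  carrier : Type u
  t : carrier → X
  s : carrier → X

variable {X : Type u}

/-- A morphism of spans: a map commuting with the source and target maps. -/
@[ext]
structure Span.Hom (M N : Span X) : Type u where
  toFun : M.carrier → N.carrier
  t_toFun : ∀ m, N.t (toFun m) = M.t m
  s_toFun : ∀ m, N.s (toFun m) = M.s m

/-- The category `span(X)`. -/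
instance : Category (Span X) where
  Hom M N := Span.Hom M N
  id M := { toFun := fun m => m, t_toFun := fun _ => rfl, s_toFun := fun _ => rfl }
  comp f g :=
    { toFun := fun m => g.toFun (f.toFun m)
      t_toFun := fun m => (g.t_toFun _).trans (f.t_toFun m)
      s_toFun := fun m => (g.s_toFun _).trans (f.s_toFun m) }

/-- The product `M ∘ N = {(m, n) | s m = t n}` of spans. -/
abbrev circ (M N : Span X) : Span X where
  carrier := {p : M.carrier × N.carrier // M.s p.1 = N.t p.2}
  t p := M.t p.1.1
  s p := N.s p.1.2

/-- The product `M • N = {(m, n) | s m = s n, t m = t n}` of spans. -/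
abbrev bullet (M N : Span X) : Span X where
  carrier := {p : M.carrier × N.carrier // M.s p.1 = N.s p.2 ∧ M.t p.1 = N.t p.2}
  t p := M.t p.1.1
  s p := M.s p.1.1

/-- The unit `I = X` of the product `∘`, with identity source and target maps. -/
abbrev unitI (X : Type u) : Span X where
  carrier := X
  t x := x
  s x := x

/-- The functor `(-) • N : span(X) ⥤ span(X)`. -/
def bulletRight (N : Span X) : Span X ⥤ Span X where
  obj M := bullet M N
  map f :=
    { toFun := fun p => ⟨(f.toFun p.1.1, p.1.2),
        (f.s_toFun _).trans p.2.1, (f.t_toFun _).trans p.2.2⟩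
      t_toFun := fun _ => f.t_toFun _
      s_toFun := fun _ => f.s_toFun _ }

/-- The embedding of `set/X` into `span(X)`, as the spans with equal source and target maps. -/
def sliceToSpan : Over X ⥤ Span X where
  obj Z := { carrier := Z.left, t := fun z => Z.hom z, s := fun z => Z.hom z }
  map {Z W} f :=
    { toFun := fun z => f.left z
      t_toFun := fun z => ConcreteCategory.congr_hom (Over.w f) z
      s_toFun := fun z => ConcreteCategory.congr_hom (Over.w f) z }

section SmallCat

variable (X) [SmallCategory X]

/-- The span of all arrows of a small category with object set `X`: an arrow `x ⟶ y` has source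
`x` and target `y`. -/
abbrev arrows : Span X where
  carrier := Quiver.Total X
  t a := a.right
  s a := a.left

variable {X}

/-- The multiplication `a.b` of arrows with `s a = t b`, that is, first `b` and then `a`. -/
def mul (a b : (arrows X).carrier) (h : (arrows X).s a = (arrows X).t b) : (arrows X).carrier :=
  { left := b.left, right := a.right, hom := b.hom ≫ eqToHom h.symm ≫ a.hom }

/-- The identity arrow at `x`. -/
def one (x : X) : (arrows X).carrier := { left := x, right := x, hom := 𝟙 x }

theorem mul_one (a : (arrows X).carrier) (x : X) (h : (arrows X).s a = x) :
    mul a (one x) h = a := by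
  subst h
  cases a
  simp [mul, one]

theorem mul_assoc (a b c : (arrows X).carrier) (h : (arrows X).s a = (arrows X).t b)
    (h' : (arrows X).s b = (arrows X).t c) :
    mul (mul a b h) c h' = mul a (mul b c h') h := by
  obtain ⟨x, _, f⟩ := a
  obtain ⟨w, y, g⟩ := b
  obtain ⟨_, z, k⟩ := c
  obtain rfl : x = y := h
  obtain rfl : w = z := h'
  have hm : ∀ {p q r : X} (m : q ⟶ r) (n : p ⟶ q) (e : q = q),
      mul (X := X) ⟨q, r, m⟩ ⟨p, q, n⟩ e = ⟨p, r, n ≫ m⟩ := fun m n e => by simp [mul]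
  have h1 := (congrArg (fun v => mul (X := X) ⟨_, _, v⟩ ⟨_, _, k⟩ rfl)
    (show g ≫ 𝟙 _ ≫ f = g ≫ f by simp)).trans (hm (g ≫ f) k rfl)
  have h2 := (congrArg (fun v => mul (X := X) ⟨_, _, f⟩ ⟨_, _, v⟩ rfl)
    (show k ≫ 𝟙 _ ≫ g = k ≫ g by simp)).trans (hm f (k ≫ g) rfl)
  rw [Category.assoc] at h2
  exact h1.trans h2.symm

variable (X)

/-- Right modules over a small category with object set `X`, regarded as a monoid in
`(span(X), ∘, I)`: a span `Q` with an associative and unital map of spans `Q ∘ A ⟶ Q`. -/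
structure RMod : Type (u + 1) where
  span : Span X
  act : circ span (arrows X) ⟶ span
  act_one : ∀ q, act.toFun ⟨(q, one (span.s q)), rfl⟩ = q
  act_mul : ∀ q a b (h : span.s q = (arrows X).t a) (h' : (arrows X).s a = (arrows X).t b),
    act.toFun ⟨(act.toFun ⟨(q, a), h⟩, b), (act.s_toFun _).trans h'⟩ =
      act.toFun ⟨(q, mul a b h'), h⟩

variable {X}

/-- A morphism of modules: a map of spans commuting with the actions. -/
@[ext]
structure RMod.Hom (Q R : RMod X) : Type u where
  map : Q.span ⟶ R.span
  map_act : ∀ q a (h : Q.span.s q = (arrows X).t a),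
    map.toFun (Q.act.toFun ⟨(q, a), h⟩) =
      R.act.toFun ⟨(map.toFun q, a), (map.s_toFun q).trans h⟩

/-- The category of right modules. -/
instance : Category (RMod X) where
  Hom Q R := RMod.Hom Q R
  id Q := { map := 𝟙 Q.span, map_act := fun _ _ _ => rfl }
  comp {P Q R} f g :=
    { map := f.map ≫ g.map
      map_act := fun q a h => by
        have h1 := f.map_act q a h
        have h2 := g.map_act (f.map.toFun q) a ((f.map.s_toFun q).trans h)
        exact (congrArg g.map.toFun h1).trans h2 }

variable (X)

/-- The forgetful functor from modules to spans. -/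
def forget : RMod X ⥤ Span X where
  obj Q := Q.span
  map f := f.map

/-- The free module functor `(-) ∘ A`, with action `(m, a).b = (m, a.b)`. -/
def free : Span X ⥤ RMod X where
  obj M :=
    { span := circ M (arrows X)
      act :=
        { toFun := fun p => ⟨(p.1.1.1.1, mul p.1.1.1.2 p.1.2 p.2), p.1.1.2⟩
          t_toFun := fun _ => rfl
          s_toFun := fun _ => rfl }
      act_one := fun q => Subtype.ext (Prod.ext rfl (mul_one q.1.2 _ rfl))
      act_mul := fun q a b h h' => Subtype.ext (Prod.ext rfl (mul_assoc q.1.2 a b h h')) }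
  map f :=
    { map :=
        { toFun := fun p => ⟨(f.toFun p.1.1, p.1.2), (f.s_toFun _).trans p.2⟩
          t_toFun := fun _ => f.t_toFun _
          s_toFun := fun _ => rfl }
      map_act := fun _ _ _ => rfl }

/-- The small category as a right module over itself, by multiplication. -/
def regular : RMod X where
  span := arrows X
  act :=
    { toFun := fun p => mul p.1.1 p.1.2 p.2
      t_toFun := fun _ => rfl
      s_toFun := fun _ => rfl }
  act_one := fun a => mul_one a _ rfl
  act_mul := mul_assoc

/-- The functor `(-) • A` on modules, with diagonal action `(q, a).b = (q.b, a.b)`. -/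
def bulletArrows : RMod X ⥤ RMod X where
  obj Q :=
    { span := bullet Q.span (arrows X)
      act :=
        { toFun := fun p =>
            ⟨(Q.act.toFun ⟨(p.1.1.1.1, p.1.2), p.2⟩,
                mul p.1.1.1.2 p.1.2 (p.1.1.2.1.symm.trans p.2)),
              Q.act.s_toFun _, (Q.act.t_toFun _).trans p.1.1.2.2⟩
          t_toFun := fun _ => Q.act.t_toFun _
          s_toFun := fun _ => Q.act.s_toFun _ }
      act_one := fun q =>
        Subtype.ext (Prod.ext (Q.act_one q.1.1) (mul_one q.1.2 _ q.2.1.symm))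
      act_mul := fun q a b h h' =>
        Subtype.ext (Prod.ext (Q.act_mul q.1.1 a b h h')
          (mul_assoc q.1.2 a b (q.2.1.symm.trans h) h')) }
  map f :=
    { map := (bulletRight (arrows X)).map f.map
      map_act := fun q a h => Subtype.ext (Prod.ext (f.map_act q.1.1 a h) rfl) }

/-- The canonical natural transformation with components
`β_Q : (Q • I) ∘ A ⟶ Q • A`, `(q, a) ↦ (q.a, a)`, for all modules `Q`. An element of
`(Q • I) ∘ A` is written `((q, x), a)`, where `s q = x = t q` and `x = t a`. -/
def beta : forget X ⋙ bulletRight (unitI X) ⋙ free X ⟶ bulletArrows X where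
  app Q :=
    { map :=
        { toFun := fun p =>
            ⟨(Q.act.toFun ⟨(p.1.1.1.1, p.1.2), p.2⟩, p.1.2),
              Q.act.s_toFun _,
              (Q.act.t_toFun _).trans (p.1.1.2.2.trans (p.1.1.2.1.symm.trans p.2))⟩
          t_toFun := fun _ => Q.act.t_toFun _
          s_toFun := fun _ => Q.act.s_toFun _ }
      map_act := fun q a h =>
        Subtype.ext (Prod.ext (Q.act_mul q.1.1.1.1 q.1.2 a q.2 h).symm rfl) }
  naturality Q R f := by
    refine RMod.Hom.ext (Span.Hom.ext (funext fun p => ?_))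
    exact Subtype.ext (Prod.ext (f.map_act p.1.1.1.1 p.1.2 p.2).symm rfl)

/-- The category of Hopf modules: a module `Q` with a morphism of modules `c : Q ⟶ A` to the
regular module, and morphisms of modules commuting with the maps `c`. (Since `•` is the cartesian
product of spans, coactions `Q ⟶ Q • A` are exactly the maps `q ↦ (q, c q)`.) -/
abbrev HopfMod : Type (u + 1) := Over (regular X)

/-- The canonical comparison functor `(-) ∘ A` from `set/X` to Hopf modules. It sends `Z` to the
free module `Z ∘ A` with `c (z, a) = a`. -/
def comparison : Over X ⥤ HopfMod X where
  obj Z :=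
    let c : RMod.Hom ((free X).obj (sliceToSpan.obj Z)) (regular X) :=
      { map :=
          { toFun := fun p => p.1.2
            t_toFun := fun p => p.2.symm
            s_toFun := fun _ => rfl }
        map_act := fun _ _ _ => rfl }
    Over.mk (Y := (free X).obj (sliceToSpan.obj Z)) c
  map f := Over.homMk ((free X).map (sliceToSpan.map f)) rfl

end SmallCat

end SpanHopf

/-! If arrows are invertible, `q` can be recovered from `q.a` and `a`: the inverse of `beta` is `(q,
a) ↦ (q.a⁻¹, a)`. Likewise a Hopf module `(Q, c)` is free on its coinvariants, the `q` with `c q` an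
identity, through `q ↦ (q.(c q)⁻¹, c q)`. The comparison functor is fully faithful for every
category, so only essential surjectivity needs inverses.

Conversely, fix `f : x ⟶ y` and take the free module on `pointSpan x y`: arrows into `x`, with
target relabelled `y`. Surjectivity of `beta` at this module gives a retraction of `f`. Making it a
Hopf module by `b ↦ f.b` and using essential surjectivity gives a section of `f`. One-sided inverses
for all arrows suffice for a groupoid. -/

namespace SpanHopf

/-! ### One-sided and two-sided inverses of arrows -/

section Inverses

variable {X : Type u} [SmallCategory X]

theorem mul_mk {x y z : X} (f : y ⟶ z) (g : x ⟶ y) (h : y = y) :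
    mul (X := X) ⟨y, z, f⟩ ⟨x, y, g⟩ h = ⟨x, z, g ≫ f⟩ := by
  simp [mul]

theorem one_mul (a : (arrows X).carrier) (x : X) (h : x = (arrows X).t a) :
    mul (one x) a h = a := by
  subst h
  obtain ⟨y, z, f⟩ := a
  exact (mul_mk (𝟙 z) f rfl).trans (by rw [Category.comp_id])

theorem mul_congr {a a' b b' : (arrows X).carrier} (ha : a = a') (hb : b = b')
    (h : (arrows X).s a = (arrows X).t b) (h' : (arrows X).s a' = (arrows X).t b') :
    mul a b h = mul a' b' h' := by
  subst ha hb
  rfl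

theorem total_mk_injective {x y : X} {f g : x ⟶ y}
    (h : (⟨x, y, f⟩ : (arrows X).carrier) = ⟨x, y, g⟩) : f = g := by
  cases h
  rfl

/-- In a groupoid, the inverse of an arrow. -/
noncomputable def inv [IsGroupoid X] (a : (arrows X).carrier) : (arrows X).carrier :=
  ⟨a.right, a.left, CategoryTheory.inv a.hom⟩

theorem mul_inv [IsGroupoid X] (a : (arrows X).carrier) : mul a (inv a) rfl = one a.right := by
  obtain ⟨x, y, f⟩ := a
  exact (mul_mk f _ rfl).trans (by rw [IsIso.inv_hom_id]; rfl)

theorem inv_mul [IsGroupoid X] (a : (arrows X).carrier) : mul (inv a) a rfl = one a.left := by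
  obtain ⟨x, y, f⟩ := a
  exact (mul_mk _ f rfl).trans (by rw [IsIso.hom_inv_id]; rfl)

/-- The equation in the total span also compares endpoints, which forces `b` to run from `y` to `x`;
only then does it become an equation between morphisms of one hom type. -/
theorem exists_comp_eq_id_of_mul_eq_one {x y : X} {f : x ⟶ y} {b : (arrows X).carrier}
    {h : x = (arrows X).t b} (e : mul ⟨x, y, f⟩ b h = one y) : ∃ g : y ⟶ x, g ≫ f = 𝟙 y := by
  obtain ⟨w, z, g⟩ := b
  obtain rfl : x = z := h
  obtain rfl : w = y := congrArg (fun a : (arrows X).carrier => a.left) e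
  exact ⟨g, total_mk_injective ((mul_mk f g rfl).symm.trans e)⟩

theorem exists_id_eq_comp_of_mul_eq_one {x y : X} {f : x ⟶ y} {b : (arrows X).carrier}
    {h : (arrows X).s b = y} (e : mul b ⟨x, y, f⟩ h = one x) : ∃ g : y ⟶ x, f ≫ g = 𝟙 x := by
  obtain ⟨w, z, g⟩ := b
  obtain rfl : w = y := h
  obtain rfl : z = x := congrArg (fun a : (arrows X).carrier => a.right) e
  exact ⟨g, total_mk_injective ((mul_mk g f rfl).symm.trans e)⟩

/-- A section `g` of `f` has a section `k` itself; then `g` has inverses on both sides, so `k = f`.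
-/
theorem isGroupoid_of_exists_section (H : ∀ {x y : X} (f : x ⟶ y), ∃ g : y ⟶ x, g ≫ f = 𝟙 y) :
    IsGroupoid X where
  all_isIso {x y} f := by
    obtain ⟨g, hg⟩ := H f
    obtain ⟨k, hk⟩ := H g
    have : k = f := by
      calc k = k ≫ g ≫ f := by rw [hg, Category.comp_id]
        _ = f := by rw [← Category.assoc, hk, Category.id_comp]
    exact ⟨g, by rw [← this, hk], hg⟩

theorem isGroupoid_of_exists_retraction
    (H : ∀ {x y : X} (f : x ⟶ y), ∃ g : y ⟶ x, f ≫ g = 𝟙 x) : IsGroupoid X where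
  all_isIso {x y} f := by
    obtain ⟨g, hg⟩ := H f
    obtain ⟨k, hk⟩ := H g
    have : k = f := by
      calc k = (f ≫ g) ≫ k := by rw [hg, Category.id_comp]
        _ = f := by rw [Category.assoc, hk, Category.comp_id]
    exact ⟨g, hg, by rw [← this, hk]⟩

end Inverses

/-! ### Modules and the cancellation of invertible arrows -/

section Modules

variable {X : Type u} [SmallCategory X]

theorem RMod.act_congr (Q : RMod X) {q q' : Q.span.carrier} {a a' : (arrows X).carrier}
    (hq : q = q') (ha : a = a') (h : Q.span.s q = (arrows X).t a)
    (h' : Q.span.s q' = (arrows X).t a') :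
    Q.act.toFun ⟨(q, a), h⟩ = Q.act.toFun ⟨(q', a'), h'⟩ := by
  subst hq ha
  rfl

theorem RMod.act_of_eq_one (Q : RMod X) (q : Q.span.carrier) {a : (arrows X).carrier} {x : X}
    (ha : a = one x) (h : Q.span.s q = (arrows X).t a) : Q.act.toFun ⟨(q, a), h⟩ = q := by
  subst ha
  obtain rfl : Q.span.s q = x := h
  exact Q.act_one q

theorem RMod.act_act_inv [IsGroupoid X] (Q : RMod X) (q : Q.span.carrier)
    (a : (arrows X).carrier) (h : Q.span.s q = (arrows X).t a)
    (h' : Q.span.s (Q.act.toFun ⟨(q, a), h⟩) = (arrows X).t (inv a)) :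
    Q.act.toFun ⟨(Q.act.toFun ⟨(q, a), h⟩, inv a), h'⟩ = q :=
  (Q.act_mul q a (inv a) h rfl).trans (Q.act_of_eq_one q (mul_inv a) h)

theorem RMod.act_inv_act [IsGroupoid X] (Q : RMod X) (q : Q.span.carrier)
    (a : (arrows X).carrier) (h : Q.span.s q = (arrows X).t (inv a))
    (h' : Q.span.s (Q.act.toFun ⟨(q, inv a), h⟩) = (arrows X).t a) :
    Q.act.toFun ⟨(Q.act.toFun ⟨(q, inv a), h⟩, a), h'⟩ = q :=
  (Q.act_mul q (inv a) a h rfl).trans (Q.act_of_eq_one q (inv_mul a) h)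

theorem RMod.isIso_of_bijective {Q R : RMod X} (f : Q ⟶ R)
    (hf : Function.Bijective f.map.toFun) : IsIso f := by
  let e := Equiv.ofBijective _ hf
  have he : ∀ r, f.map.toFun (e.symm r) = r := e.apply_symm_apply
  let gs : R.span ⟶ Q.span :=
    { toFun := e.symm
      t_toFun := fun r => (f.map.t_toFun _).symm.trans (congrArg R.span.t (he r))
      s_toFun := fun r => (f.map.s_toFun _).symm.trans (congrArg R.span.s (he r)) }
  let g : R ⟶ Q :=
    { map := gs
      map_act := fun r a h => hf.1 <| (he _).trans <|
        (R.act_congr (he r).symm rfl _ _).trans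
          (f.map_act (e.symm r) a ((gs.s_toFun r).trans h)).symm }
  exact ⟨g, RMod.Hom.ext (Span.Hom.ext (funext e.symm_apply_apply)),
    RMod.Hom.ext (Span.Hom.ext (funext he))⟩

theorem RMod.surjective_of_isIso {Q R : RMod X} (f : Q ⟶ R) [IsIso f] :
    Function.Surjective f.map.toFun := fun r =>
  ⟨(CategoryTheory.inv f).map.toFun r,
    congrArg (fun g : R ⟶ R => g.map.toFun r) (IsIso.inv_hom_id f)⟩

/-! ### The transformation `beta` -/

/-- The span over `X` with a single element, of source `x` and target `y`. -/
abbrev pointSpan (x y : X) : Span X where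
  carrier := PUnit
  t _ := y
  s _ := x

theorem isIso_beta [IsGroupoid X] : IsIso (beta X) := by
  have (Q : RMod X) : IsIso ((beta X).app Q) := by
    refine RMod.isIso_of_bijective _ ⟨?_, ?_⟩
    · rintro ⟨⟨⟨⟨q, x⟩, hs, ht⟩, a⟩, h⟩ ⟨⟨⟨⟨q', x'⟩, hs', ht'⟩, a'⟩, h'⟩ e
      have e1 : Q.act.toFun ⟨(q, a), h⟩ = Q.act.toFun ⟨(q', a'), h'⟩ :=
        congrArg (fun p => p.1.1) e
      obtain rfl : a = a' := congrArg (fun p => p.1.2) e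
      obtain rfl : q = q' :=
        (Q.act_act_inv q a h (Q.act.s_toFun _)).symm.trans
          ((Q.act_congr e1 rfl _ _).trans (Q.act_act_inv q' a h' (Q.act.s_toFun _)))
      obtain rfl : x = x' := hs.symm.trans hs'
      rfl
    · rintro ⟨⟨q, a⟩, hs, ht⟩
      refine ⟨⟨(⟨(Q.act.toFun ⟨(q, inv a), hs⟩, a.right), Q.act.s_toFun _,
        (Q.act.t_toFun _).trans ht⟩, a), Q.act.s_toFun _⟩, ?_⟩
      exact Subtype.ext (Prod.ext (Q.act_inv_act q a hs _) rfl)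
  exact NatIso.isIso_of_isIso_app _

theorem isGroupoid_of_isIso_beta [IsIso (beta X)] : IsGroupoid X := by
  refine isGroupoid_of_exists_retraction fun {x y} f => ?_
  obtain ⟨⟨⟨⟨⟨⟨⟨u, b⟩, hb⟩, z⟩, hz⟩, a⟩, ha⟩, e⟩ :=
    (RMod.surjective_of_isIso ((beta X).app ((free X).obj (pointSpan x y)))
      -- The generator has source `x` and target `y`, so it pairs with `f` in `Q • A`. A preimage
      -- consists of some `b` and `f` itself, with `b.f` equal to the identity at `x`.
      ⟨(⟨(PUnit.unit, one x), rfl⟩, ⟨x, y, f⟩), rfl, rfl⟩)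
  obtain rfl : a = ⟨x, y, f⟩ := congrArg (fun p => p.1.2) e
  have e1 : mul b ⟨x, y, f⟩ ha = one x := congrArg (fun p => p.1.1.1.2) e
  exact exists_id_eq_comp_of_mul_eq_one e1

/-! ### The comparison functor -/

instance : (comparison X).Faithful where
  map_injective {Z W} f g e := by
    ext z
    exact congrArg (fun k : (comparison X).obj Z ⟶ (comparison X).obj W =>
      (k.left.map.toFun ⟨(z, one (Z.hom z)), rfl⟩).1.1) e

/-- Since `(z, a) = (z, 1).a`, a Hopf module map is determined by the images of the `(z, 1)`;
compatibility with `c` fixes the second component. -/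
instance : (comparison X).Full where
  map_surjective {Z W} g := by
    let z1 (z : Z.left) : ((free X).obj (sliceToSpan.obj Z)).span.carrier :=
      ⟨(z, one (Z.hom z)), rfl⟩
    have hc (p) : (g.left.map.toFun p).1.2 = p.1.2 :=
      congrArg (fun k : ((comparison X).obj Z).left ⟶ regular X => k.map.toFun p) (Over.w g)
    refine ⟨Over.homMk (TypeCat.ofHom fun z => (g.left.map.toFun (z1 z)).1.1) ?_, ?_⟩
    · ext z
      exact g.left.map.t_toFun (z1 z)
    · refine Over.OverMorphism.ext (RMod.Hom.ext (Span.Hom.ext (funext fun p => ?_)))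
      obtain ⟨⟨z, a⟩, h⟩ := p
      have h1 := g.left.map_act (z1 z) a h
      have h2 : ((free X).obj (sliceToSpan.obj Z)).act.toFun ⟨(z1 z, a), h⟩ = ⟨(z, a), h⟩ :=
        Subtype.ext (Prod.ext rfl (one_mul a _ h))
      have h3 := (congrArg g.left.map.toFun h2).symm.trans h1
      exact Subtype.ext (Prod.ext (congrArg (fun p => p.1.1) h3).symm (hc ⟨(z, a), h⟩).symm)

theorem isEquivalence_comparison [IsGroupoid X] : (comparison X).IsEquivalence where
  essSurj := ⟨fun P => by
    let Q : RMod X := P.left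
    let c : RMod.Hom Q (regular X) := P.hom
    have ct (q) : (c.map.toFun q).right = Q.span.t q := c.map.t_toFun q
    have cs (q) : (c.map.toFun q).left = Q.span.s q := c.map.s_toFun q
    -- The coinvariants of `Q`; their source and target agree because those of an identity arrow do.
    let Z : Over X := Over.mk (Y := {q : Q.span.carrier // c.map.toFun q = one (Q.span.s q)})
      (TypeCat.ofHom fun z => Q.span.s z.1)
    have zt (z : Z.left) : Q.span.t z.1 = Q.span.s z.1 :=
      (ct z.1).symm.trans (congrArg (fun a : (arrows X).carrier => a.right) z.2)
    let f : RMod.Hom ((free X).obj (sliceToSpan.obj Z)) Q :=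
      { map :=
          { toFun := fun p => Q.act.toFun ⟨(p.1.1.1, p.1.2), p.2⟩
            t_toFun := fun p => (Q.act.t_toFun _).trans (zt p.1.1)
            s_toFun := fun p => Q.act.s_toFun _ }
        map_act := fun p a h => (Q.act_mul p.1.1.1 p.1.2 a p.2 h).symm }
    -- `c (z.a) = (c z).a = a`. This makes `f` a morphism over `A`, and it recovers `a` in the
    -- injectivity argument.
    have cf (p) : c.map.toFun (f.map.toFun p) = p.1.2 :=
      (c.map_act p.1.1.1 p.1.2 p.2).trans
        ((mul_congr p.1.1.2 rfl ((c.map.s_toFun _).trans p.2) p.2).trans (one_mul _ _ p.2))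
    have : IsIso (C := RMod X) (X := (free X).obj (sliceToSpan.obj Z)) (Y := Q) f := by
      refine RMod.isIso_of_bijective _ ⟨fun p p' e => ?_, fun q => ?_⟩
      · have e2 : p.1.2 = p'.1.2 := (cf p).symm.trans ((congrArg c.map.toFun e).trans (cf p'))
        obtain ⟨⟨⟨q, hq⟩, a⟩, h⟩ := p
        obtain ⟨⟨⟨q', hq'⟩, a'⟩, h'⟩ := p'
        obtain rfl : a = a' := e2
        obtain rfl : q = q' :=
          (Q.act_act_inv q a h (Q.act.s_toFun _)).symm.trans
            ((Q.act_congr e rfl _ _).trans (Q.act_act_inv q' a h' (Q.act.s_toFun _)))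
        rfl
      · let a := c.map.toFun q
        have ha : Q.span.s q = (arrows X).t (inv a) := (cs q).symm
        refine ⟨⟨(⟨Q.act.toFun ⟨(q, inv a), ha⟩, ?_⟩, a), Q.act.s_toFun _⟩, ?_⟩
        -- `q.a⁻¹` is coinvariant: `c (q.a⁻¹) = a.a⁻¹` is an identity.
        · exact (c.map_act q (inv a) ha).trans
            ((mul_inv a).trans (congrArg one (Q.act.s_toFun ⟨(q, inv a), ha⟩).symm))
        · exact Q.act_inv_act q a ha _
    exact ⟨Z, ⟨Over.isoMk (asIso (C := RMod X) (X := (free X).obj (sliceToSpan.obj Z)) (Y := Q) f)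
      (RMod.Hom.ext (Span.Hom.ext (funext cf)))⟩⟩⟩

theorem isGroupoid_of_essSurj_comparison [(comparison X).EssSurj] : IsGroupoid X := by
  refine isGroupoid_of_exists_section fun {x y} f => ?_
  let c : RMod.Hom ((free X).obj (pointSpan x y)) (regular X) :=
    { map :=
        { toFun := fun p => mul ⟨x, y, f⟩ p.1.2 p.2
          t_toFun := fun _ => rfl
          s_toFun := fun _ => rfl }
      map_act := fun p a h => (mul_assoc _ _ _ p.2 h).symm }
  let P : HopfMod X := Over.mk (Y := (free X).obj (pointSpan x y)) c
  let Z := (comparison X).objPreimage P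
  let e : (comparison X).obj Z ≅ P := (comparison X).objObjPreimageIso P
  -- The generator of `P` has target `y`, so its image provides an element of `Z` over `y`.
  let p := e.inv.left.map.toFun ⟨(PUnit.unit, one x), rfl⟩
  have hp : Z.hom p.1.1 = y := e.inv.left.map.t_toFun ⟨(PUnit.unit, one x), rfl⟩
  -- Over that element lies a pair whose `c`-value is the identity at `y`. Carried back to `P`,
  -- where `c` is composition with `f`, it yields a section of `f`.
  let r := e.hom.left.map.toFun ⟨(p.1.1, one y), hp⟩
  have hr : mul ⟨x, y, f⟩ r.1.2 r.2 = one y :=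
    congrArg (fun k : ((comparison X).obj Z).left ⟶ regular X =>
      k.map.toFun ⟨(p.1.1, one y), hp⟩) (Over.w e.hom)
  exact exists_comp_eq_id_of_mul_eq_one hr

end Modules

end SpanHopf

theorem corollary4p6 (X : Type u) [SmallCategory X] :
    List.TFAE [IsGroupoid X,
      IsIso (SpanHopf.beta X),
      (SpanHopf.comparison X).IsEquivalence] := by
  tfae_have 1 → 2 := fun _ => SpanHopf.isIso_beta
  tfae_have 2 → 1 := fun _ => SpanHopf.isGroupoid_of_isIso_beta
  tfae_have 1 → 3 := fun _ => SpanHopf.isEquivalence_comparison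
  tfae_have 3 → 1 := fun _ => SpanHopf.isGroupoid_of_essSurj_comparison
  tfae_finish
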